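/- Work in the ultrapower model of ${}^*\mathbb{N}$, ${}^*\mathbb{R}$. For unlimited $N\in{}^*\mathbb{N}$ let $\mathrm{I}=\{0,\frac1N,\dots,\frac{N-1}N,1\}$, each point $\neq 1$ having mass $\frac1N$; functions on $\mathrm{I}$ are internal and integrals $\int_A f\,d\lambda$ over internal sets $A$ are hyperfinite sums. We write $a\simeq b$ ("$a$ is in the halo of $b$") if $a-b$ is infinitesimal. A set of grid points is rare if for every standard $\varepsilon>0$ it is contained in an internal set of measure $\le\varepsilon$; an internal set is quadrable if its boundary (the grid points infinitely near both to points of the set and to grid points outside it) is rare. A function $f$ is $S$-integrable if $\int|f|d\lambda$ is limited and $\int_A|f|d\lambda\simeq0$ whenever $\lambda(A)\simeq 0$; Lebesgue integrable if moreover it is $S$-continuous off a rare set; fast oscillating if it is $S$-integrable and $\int_A f\,d\lambda\simeq0$ for all quadrable $A$. An $S$-integrable $\mathfrak n$ is a noise of mean $m$ if $m$ is Lebesgue integrable and $\mathfrak n-m$ is fast oscillating. A function $F$ on $\mathrm I$ has shadow $f:[0,1]\to\mathbb R$ if $F(\tau)\simeq f(t)$ whenever $\tau\in \mathrm I$, $t\in[0,1]$,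 $\tau\simeq t$. A known expression is $E[u](t)=e(t)+L_E[u](t)$ where $e$ is a real function that is analytic on $[0,1]$ with $e(0)=0$, and $L_E[u](t)=\sum_{\rm finite} c\int_0^t\cdots\int_0^{\tau_2}\int_0^{\tau_1}\sigma^{\nu}u(\sigma)\,d\sigma\,d\tau_1\cdots d\tau_{k-1}$ ($k\ge1$ integrations, $\nu\ge0$, $c\in\mathbb R$); on functions on $\mathrm I$ the integrals are replaced by hyperfinite sums. Let $P,Q$ be known expressions and $d\in\mathbb N$. The real parameter (symbol) $\theta$ is linearly identifiable from $\bar x:[0,1]\to\mathbb R$ through $P,Q$ if $P[\bar x]\,\theta=Q[\bar x]$ on $[0,1]$ and $P[\bar x]\not\equiv0$. Then there exist known expressions $P',Q'$, depending only on $P,Q,d$, whose linear parts annihilate on $[0,1]$ every polynomial of degree $\le d$ and such that the following holds for every unlimited $N$, every $\theta\in\mathbb R$, every signal $x$ on $\mathrm I$ with a shadow $\bar x$ which is analytic on $[0,1]$, is not annihilated on $[0,1]$ by any power of $\frac{d}{dt}$, and from which $\theta$ is linearly identifiable through $P,Q$, and every noise $\mathfrak n$ on $\mathrm I$ of a mean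 $m$ whose shadow is a polynomial $p$ of degree $\le d$. Put $y=x+\mathfrak n$, $\mathfrak n_0=\mathfrak n-p$, $\delta=P'[y]$, $\bar\delta=P'[\bar x]$ (the divisor) and $[\theta]_e(t)=Q'[y](t)/P'[y](t)$. 1. $\bar\delta$ is analytic on $[0,1]$, $\bar\delta(0)=0$, and $\bar\delta$ is the shadow of $\delta$. 2. $\delta(t)\left([\theta]_e(t)-\theta\right)\simeq L_{Q'}[\mathfrak n_0](t)-\theta L_{P'}[\mathfrak n_0](t)$ for every $t\in\mathrm I$ (where a quotient by $0$ is read as $0$). 3. $\bar\delta\not\equiv0$ on $[0,1]$ if the coefficient $P[\bar x]$ of $\theta$ is not annihilated on $[0,1]$ by a power of $\frac d{dt}$; in particular $\bar\delta\not\equiv0$ whenever $L_P$ has exactly one term, with nonzero coefficient, and the known part of $P$ is annihilated on $[0,1]$ by a power of $\frac d{dt}$. 4. For every $t\in\mathrm I$ which is not in the halo of a zero of $\bar\delta$ in $[0,1]$, $\delta(t)\neq0$ and $[\theta]_e(t)$ lies in the halo of $\theta$. -/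

import Mathlib

open Filter

noncomputable section

namespace BurstNoise

/-! ### Nonstandard preliminaries

Everything is done in the ultrapower that defines Mathlib's hyperreals. Internal objects are germs
of sequences of standard objects. -/

/-- The hypernatural numbers `*ℕ`. -/
abbrev Hypernat : Type := Germ (hyperfilter ℕ : Filter ℕ) ℕ

/-- Internal functions `*ℕ → *ℝ`. A function on the hyperfinite grid
`I = {0, 1/N, …, (N-1)/N, 1}` is represented by the internal function `K ↦ f (K / N)`, of which
only the values at `K ≤ N` are used. -/
abbrev InternalFun : Type := Germ (hyperfilter ℕ : Filter ℕ) (ℕ → ℝ)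

/-- Internal subsets of `*ℕ`. -/
abbrev InternalSet : Type := Germ (hyperfilter ℕ : Filter ℕ) (Set ℕ)

/-- The value of an internal function at a hypernatural number. -/
def InternalFun.eval (F : InternalFun) (K : Hypernat) : ℝ* :=
  (Germ.map₂ (fun (f : ℕ → ℝ) (k : ℕ) => f k) F K : Germ (hyperfilter ℕ : Filter ℕ) ℝ)

/-- Membership in an internal set. -/
def InternalSet.Mem (A : InternalSet) (K : Hypernat) : Prop :=
  Germ.LiftRel (fun (s : Set ℕ) (k : ℕ) => k ∈ s) A K

/-- `N` is unlimited: larger than every standard natural number. -/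
def Unlimited (N : Hypernat) : Prop := ∀ n : ℕ, (Germ.const n : Hypernat) < N

/-- `x ≃ y`: the hyperreals `x` and `y` are infinitely near, i.e. `x` is in the halo of `y`. -/
def Near (x y : ℝ*) : Prop := ∀ ε : ℝ, 0 < ε → |x - y| < (ε : ℝ*)

/-- A limited hyperreal. -/
def Limited (x : ℝ*) : Prop := ∃ r : ℝ, |x| ≤ (r : ℝ*)

/-- The point `K / N` of the grid, as a hyperreal. -/
def time (N K : Hypernat) : ℝ* :=
  (Germ.map₂ (fun n k : ℕ => (k : ℝ) / (n : ℝ)) N K : Germ (hyperfilter ℕ : Filter ℕ) ℝ)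

/-- The restriction to the grid of the nonstandard extension of a standard function. -/
def onGrid (N : Hypernat) (g : ℝ → ℝ) : InternalFun :=
  Germ.map (fun (n j : ℕ) => g ((j : ℝ) / (n : ℝ))) N

/-- The function `F` on the grid has the standard function `f : [0, 1] → ℝ` as its shadow. -/
def HasShadow (N : Hypernat) (F : InternalFun) (f : ℝ → ℝ) : Prop :=
  ∀ K : Hypernat, K ≤ N → ∀ t ∈ Set.Icc (0 : ℝ) 1, Near (time N K) (t : ℝ*) →
    Near (F.eval K) (f t : ℝ*)

/-! ### Integration on the grid -/

/-- The cumulative sum `k ↦ (f 0 + ⋯ + f (k - 1)) / n`. -/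
def sumUpTo (n : ℕ) (f : ℕ → ℝ) (k : ℕ) : ℝ := (∑ j ∈ Finset.range k, f j) / (n : ℝ)

/-- The integral over the whole grid for the measure giving each point `≠ 1` the mass `1 / N`. -/
def integral (N : Hypernat) (F : InternalFun) : ℝ* :=
  (Germ.map₂ (fun (n : ℕ) (f : ℕ → ℝ) => sumUpTo n f n) N F :
    Germ (hyperfilter ℕ : Filter ℕ) ℝ)

/-- The internal function equal to `F` on the internal set `A` and to `0` elsewhere. -/
def restrict (A : InternalSet) (F : InternalFun) : InternalFun :=
  Germ.map₂ (fun (s : Set ℕ) (f : ℕ → ℝ) => s.indicator f) A F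

/-- The integral `∫_A F dλ` over an internal subset of the grid. -/
def integralOn (N : Hypernat) (A : InternalSet) (F : InternalFun) : ℝ* :=
  integral N (restrict A F)

/-- The measure `λ(A)` of an internal subset of the grid. -/
def measure (N : Hypernat) (A : InternalSet) : ℝ* := integralOn N A 1

/-- The pointwise absolute value of an internal function. -/
def absFun (F : InternalFun) : InternalFun := Germ.map (fun (f : ℕ → ℝ) (k : ℕ) => |f k|) F

/-- A (possibly external) set of grid points is rare if for every standard `ε > 0` it is contained
in an internal set of measure at most `ε`. -/
def Rare (N : Hypernat) (E : Set Hypernat) : Prop :=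
  ∀ ε : ℝ, 0 < ε → ∃ B : InternalSet, (∀ K ∈ E, B.Mem K) ∧ measure N B ≤ (ε : ℝ*)

/-- The boundary of an internal subset of the grid: the grid points infinitely near both to a point
of the set and to a grid point outside of it. -/
def boundary (N : Hypernat) (A : InternalSet) : Set Hypernat :=
  {K | K ≤ N ∧ (∃ L : Hypernat, L ≤ N ∧ Near (time N L) (time N K) ∧ A.Mem L) ∧
    (∃ L : Hypernat, L ≤ N ∧ Near (time N L) (time N K) ∧ ¬ A.Mem L)}

/-- Quadrable sets: internal sets with a rare boundary. -/
def Quadrable (N : Hypernat) (A : InternalSet) : Prop := Rare N (boundary N A)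

/-- `S`-integrability: `∫ |F| dλ` is limited, and `∫_A |F| dλ ≃ 0` as soon as `λ(A) ≃ 0`. -/
def SIntegrable (N : Hypernat) (F : InternalFun) : Prop :=
  Limited (integral N (absFun F)) ∧
    ∀ A : InternalSet, Near (measure N A) 0 → Near (integralOn N A (absFun F)) 0

/-- Lebesgue integrability: `S`-integrability together with `S`-continuity on the complement of a
rare set. -/
def LebesgueIntegrable (N : Hypernat) (F : InternalFun) : Prop :=
  SIntegrable N F ∧ ∃ E : Set Hypernat, Rare N E ∧
    ∀ K L : Hypernat, K ≤ N → L ≤ N → K ∉ E → L ∉ E → Near (time N K) (time N L) →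
      Near (F.eval K) (F.eval L)

/-- Fast oscillating functions: `S`-integrable, with infinitesimal integral over every quadrable
set. -/
def FastOscillating (N : Hypernat) (F : InternalFun) : Prop :=
  SIntegrable N F ∧ ∀ A : InternalSet, Quadrable N A → Near (integralOn N A F) 0

/-- `F` is a noise of mean `m` on the grid. -/
def IsNoise (N : Hypernat) (m F : InternalFun) : Prop :=
  LebesgueIntegrable N m ∧ SIntegrable N F ∧ FastOscillating N (F - m)

/-! ### Linear expressions in iterated integrals of a signal -/

/-- A known expression which is affine in a signal `u`, namely
`known(t) + ∑ c_{k,ν} ∫_0^t ⋯ ∫_0^{τ_2} ∫_0^{τ_1} σ^ν u(σ) dσ dτ_1 ⋯`, a finite sum in which the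
term with index `(k, ν)` has `k + 1 ≥ 1` successive integrations, and `known` is a known function
which is analytic on `[0, 1]` and vanishes at `0`. -/
structure IntegralForm where
  /-- the part which does not involve the signal -/
  known : ℝ → ℝ
  known_analytic : AnalyticOn ℝ known (Set.Icc 0 1)
  known_zero : known 0 = 0
  /-- the coefficients `c_{k,ν}` -/
  coeff : (ℕ × ℕ) →₀ ℝ

/-- `f ↦ (t ↦ ∫_0^t f)`. -/
def primitive (f : ℝ → ℝ) (t : ℝ) : ℝ := ∫ τ in (0 : ℝ)..t, f τ

namespace IntegralForm

/-- The linear part of the expression on a standard signal. -/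
def lin (E : IntegralForm) (u : ℝ → ℝ) (t : ℝ) : ℝ :=
  E.coeff.sum fun i c => c * (primitive^[i.1 + 1] fun τ => τ ^ i.2 * u τ) t

/-- The value of the expression on a standard signal. -/
def std (E : IntegralForm) (u : ℝ → ℝ) (t : ℝ) : ℝ := E.known t + E.lin u t

/-- The linear part on a function on the finite grid `{0, 1/n, …, 1}`, with integrals replaced by
sums. -/
def gridLin (E : IntegralForm) (n : ℕ) (f : ℕ → ℝ) (k : ℕ) : ℝ :=
  E.coeff.sum fun i c => c * ((sumUpTo n)^[i.1 + 1] fun j => ((j : ℝ) / (n : ℝ)) ^ i.2 * f j) k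

/-- The linear part of the expression on a function on the hyperfinite grid. -/
def hyperLin (E : IntegralForm) (N : Hypernat) (F : InternalFun) : InternalFun :=
  Germ.map₂ (fun (n : ℕ) (f : ℕ → ℝ) => E.gridLin n f) N F

/-- The value of the expression on a function on the hyperfinite grid. -/
def hyper (E : IntegralForm) (N : Hypernat) (F : InternalFun) : InternalFun :=
  onGrid N E.known + E.hyperLin N F

end IntegralForm

/-- The parameter `θ` is linearly identifiable from the (standard) signal `u` on `[0, 1]` through
the known expressions `P` and `Q`: one has `P[u] θ = Q[u]`, and `P[u]` is not identically zero. -/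
def Identifies (P Q : IntegralForm) (u : ℝ → ℝ) (θ : ℝ) : Prop :=
  (∀ t ∈ Set.Icc (0 : ℝ) 1, P.std u t * θ = Q.std u t) ∧ ∃ t ∈ Set.Icc (0 : ℝ) 1, P.std u t ≠ 0

/-- The estimate `[θ]_e(t)`, `t = K / N`, computed from the measured function `y` on the window
`[0, t]` by means of the expressions `P` and `Q`. -/
def estimate (P Q : IntegralForm) (N : Hypernat) (y : InternalFun) (K : Hypernat) : ℝ* :=
  (Q.hyper N y).eval K / (P.hyper N y).eval K

/-- Some power of `d/dt` annihilates `f` on `[0, 1]`. -/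
def AnnihilatedByPower (f : ℝ → ℝ) : Prop :=
  ∃ M : ℕ, ∀ t ∈ Set.Icc (0 : ℝ) 1, iteratedDerivWithin M f (Set.Icc 0 1) t = 0

end BurstNoise

end

noncomputable section

namespace BurstNoise

open Topology Set

/-! ### Internal objects as sequences -/

/-! The estimator comes from the operator `f ↦ t f - (j + 1) ∫ f`, which sends `t ^ i` to a multiple
`(i - j) / (i + 1)` of `t ^ (i + 1)` and so kills `t ^ j`. It is linear, so it preserves a relation
`P[x̄] θ = Q[x̄]`; and since `t` commutes with `k` integrations up to `k` times `k + 1` integrations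
(`mul_primitive_iterate`), it turns known expressions into known expressions (`lin_step`). On
polynomials of degree at most `d` the linear parts have exponents in some `[0, b)`. Each step with
`j = 0, 2, 4, …` raises the lower bound by 2 and the upper bound by 1, so after `b` steps nothing is
left (`lin_steps_eq_zero`).

The noise is harmless because initial segments of the grid are quadrable: the cumulative sums of `𝔫
- m` are infinitesimal, uniformly by overspill. By Abel summation the weights `σ ^ ν` preserve this,
and further integrations are Riemann sums (`unifClose_gridLin`). Hence `P'[y]` has the shadow of
`P'[x̄ + p]`, which is `P'[x̄]`; likewise for `Q'`. Dividing gives the estimate away from the zeros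
of the divisor.

The divisor does not vanish identically because a step can be undone modulo functions annihilated by
a power of `d/dt`: its derivative is the Euler operator `t f' - j f`, and
`annihilatedByPower_of_euler` pulls annihilation back through such operators. -/

theorem near_ofSeq {a b : ℕ → ℝ} :
    Near (Hyperreal.ofSeq a) (Hyperreal.ofSeq b) ↔
      ∀ ε : ℝ, 0 < ε → ∀ᶠ i in hyperfilter ℕ, |a i - b i| < ε := by
  refine forall₂_congr fun ε _ => ?_
  have h : |Hyperreal.ofSeq a - Hyperreal.ofSeq b| = Hyperreal.ofSeq (fun i => |a i - b i|) :=
    Germ.abs_def _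
  rw [h]
  exact Hyperreal.ofSeq_lt_ofSeq

theorem near_ofSeq_coe {a : ℕ → ℝ} {t : ℝ} :
    Near (Hyperreal.ofSeq a) (t : ℝ*) ↔ Tendsto a (hyperfilter ℕ) (𝓝 t) := by
  rw [Metric.tendsto_nhds]
  exact near_ofSeq (b := fun _ => t)

theorem near_ofSeq_zero {a : ℕ → ℝ} :
    Near (Hyperreal.ofSeq a) 0 ↔ Tendsto a (hyperfilter ℕ) (𝓝 0) :=
  near_ofSeq_coe (t := 0)

theorem Unlimited.tendsto {n : ℕ → ℕ} (h : Unlimited (n : Hypernat)) :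
    Tendsto n (hyperfilter ℕ) atTop := by
  refine tendsto_atTop.2 fun b => ?_
  filter_upwards [Germ.coe_lt.1 (h b)] with i hi using hi.le

theorem div_mem_Icc {k n : ℕ} (h : k ≤ n) : (k : ℝ) / n ∈ Icc (0 : ℝ) 1 :=
  ⟨by positivity, div_le_one_of_le₀ (by exact_mod_cast h) (by positivity)⟩

theorem exists_tendsto_of_mem_Icc {a : ℕ → ℝ} (h : ∀ᶠ i in hyperfilter ℕ, a i ∈ Icc (0 : ℝ) 1) :
    ∃ t ∈ Icc (0 : ℝ) 1, Tendsto a (hyperfilter ℕ) (𝓝 t) := by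
  obtain ⟨t, ht, h⟩ := isCompact_Icc.ultrafilter_le_nhds ((hyperfilter ℕ).map a)
    (le_principal_iff.2 h)
  exact ⟨t, ht, h⟩

theorem exists_near_time {N K : Hypernat} (h : K ≤ N) :
    ∃ t ∈ Icc (0 : ℝ) 1, Near (time N K) (t : ℝ*) := by
  induction N using Germ.inductionOn with | _ n
  induction K using Germ.inductionOn with | _ k
  obtain ⟨t, ht, h⟩ := exists_tendsto_of_mem_Icc (a := fun i => (k i : ℝ) / n i)
    ((Germ.coe_le.1 h).mono fun i hi => div_mem_Icc hi)
  exact ⟨t, ht, near_ofSeq_coe.2 h⟩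

/-- The grid functions `F i` on `{0, 1/n i, …, 1}` are uniformly close to `f`, in the limit. -/
def UnifClose (n : ℕ → ℕ) (F : ℕ → ℕ → ℝ) (f : ℝ → ℝ) : Prop :=
  ∀ ε : ℝ, 0 < ε → ∀ᶠ i in hyperfilter ℕ, ∀ k ≤ n i, |F i k - f ((k : ℝ) / n i)| ≤ ε

/-- Overspill: closeness at every hyperfinite index is uniform closeness. -/
theorem unifClose_of_forall {n : ℕ → ℕ} {F : ℕ → ℕ → ℝ} {f : ℝ → ℝ}
    (h : ∀ k : ℕ → ℕ, (∀ᶠ i in hyperfilter ℕ, k i ≤ n i) →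
      Tendsto (fun i => F i (k i) - f ((k i : ℝ) / n i)) (hyperfilter ℕ) (𝓝 0)) :
    UnifClose n F f := by
  intro ε hε
  by_contra hcon
  have hbad : ∀ᶠ i in hyperfilter ℕ, ∃ k ≤ n i, ε < |F i k - f ((k : ℝ) / n i)| := by
    -- For an ultrafilter, failing to hold eventually means failing eventually, so violating indices
    -- can be chosen and form one hyperfinite index.
    filter_upwards [Ultrafilter.eventually_not.2 hcon] with i hi
    push Not at hi
    exact hi
  choose! k hk using fun (i : ℕ) (hi : ∃ k ≤ n i, ε < |F i k - f ((k : ℝ) / n i)|) => hi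
  have h1 := h k (hbad.mono fun i hi => (hk i hi).1)
  have h2 := Metric.tendsto_nhds.1 h1 ε hε
  obtain ⟨i, hi, hi'⟩ := (hbad.and h2).exists
  rw [Real.dist_eq, sub_zero] at hi'
  exact absurd (hk i hi).2 hi'.not_gt

theorem UnifClose.tendsto {n : ℕ → ℕ} {F : ℕ → ℕ → ℝ} {f : ℝ → ℝ} (h : UnifClose n F f)
    {k : ℕ → ℕ} (hk : ∀ᶠ i in hyperfilter ℕ, k i ≤ n i) :
    Tendsto (fun i => F i (k i) - f ((k i : ℝ) / n i)) (hyperfilter ℕ) (𝓝 0) := by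
  refine Metric.tendsto_nhds.2 fun ε hε => ?_
  filter_upwards [h (ε / 2) (by positivity), hk] with i hi hki
  rw [Real.dist_eq, sub_zero]
  linarith [hi _ hki]

theorem tendsto_comp_div {n k : ℕ → ℕ} {f : ℝ → ℝ} (hf : ContinuousOn f (Icc 0 1))
    (hk : ∀ᶠ i in hyperfilter ℕ, k i ≤ n i) {t : ℝ} (ht : t ∈ Icc (0 : ℝ) 1)
    (h : Tendsto (fun i => (k i : ℝ) / n i) (hyperfilter ℕ) (𝓝 t)) :
    Tendsto (fun i => f ((k i : ℝ) / n i)) (hyperfilter ℕ) (𝓝 (f t)) :=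
  (hf t ht).tendsto.comp (tendsto_nhdsWithin_iff.2 ⟨h, hk.mono fun _ hi => div_mem_Icc hi⟩)

/-- Every grid point has a standard part by compactness, and continuity makes `f` there comparable
with `f` at the grid point itself. -/
theorem hasShadow_coe_iff {n : ℕ → ℕ} {F : ℕ → ℕ → ℝ} {f : ℝ → ℝ}
    (hf : ContinuousOn f (Icc 0 1)) :
    HasShadow (n : Hypernat) (F : InternalFun) f ↔ UnifClose n F f := by
  constructor
  · intro h
    refine unifClose_of_forall fun k hk => ?_
    obtain ⟨t, ht, hkt⟩ := exists_tendsto_of_mem_Icc (a := fun i => (k i : ℝ) / n i)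
      (hk.mono fun i hi => div_mem_Icc hi)
    have h1 : Tendsto (fun i => F i (k i)) (hyperfilter ℕ) (𝓝 (f t)) :=
      near_ofSeq_coe.1 (h (k : Hypernat) (Germ.coe_le.2 hk) t ht (near_ofSeq_coe.2 hkt))
    simpa using h1.sub (tendsto_comp_div hf hk ht hkt)
  · intro h K hK t ht hKt
    induction K using Germ.inductionOn with | _ k
    have hk := Germ.coe_le.1 hK
    refine near_ofSeq_coe.2 ?_
    have := (h.tendsto hk).add (tendsto_comp_div hf hk ht (near_ofSeq_coe.1 hKt))
    simpa using this

theorem UnifClose.add {n : ℕ → ℕ} {F G : ℕ → ℕ → ℝ} {f g : ℝ → ℝ} (hF : UnifClose n F f)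
    (hG : UnifClose n G g) :
    UnifClose n (fun i k => F i k + G i k) (fun t => f t + g t) := by
  intro ε hε
  filter_upwards [hF (ε / 2) (by positivity), hG (ε / 2) (by positivity)] with i h1 h2 k hk
  have h3 := abs_le.1 (h1 k hk)
  have h4 := abs_le.1 (h2 k hk)
  exact abs_le.2 ⟨by linarith, by linarith⟩

theorem UnifClose.const_mul {n : ℕ → ℕ} {F : ℕ → ℕ → ℝ} {f : ℝ → ℝ} (hF : UnifClose n F f)
    (c : ℝ) : UnifClose n (fun i k => c * F i k) (fun t => c * f t) := by
  intro ε hε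
  filter_upwards [hF (ε / (|c| + 1)) (by positivity)] with i h1 k hk
  rw [← mul_sub, abs_mul]
  calc |c| * |F i k - f (k / n i)| ≤ (|c| + 1) * (ε / (|c| + 1)) := by
        gcongr
        · linarith
        · exact h1 k hk
    _ = ε := by field_simp

theorem UnifClose.sub {n : ℕ → ℕ} {F G : ℕ → ℕ → ℝ} {f g : ℝ → ℝ} (hF : UnifClose n F f)
    (hG : UnifClose n G g) :
    UnifClose n (fun i k => F i k - G i k) (fun t => f t - g t) := by
  simpa [sub_eq_add_neg] using hF.add (hG.const_mul (-1))

theorem UnifClose.sum {ι : Type*} {n : ℕ → ℕ} {F : ι → ℕ → ℕ → ℝ} {f : ι → ℝ → ℝ}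
    (s : Finset ι) (h : ∀ a ∈ s, UnifClose n (F a) (f a)) :
    UnifClose n (fun i k => ∑ a ∈ s, F a i k) (fun t => ∑ a ∈ s, f a t) := by
  classical
  induction s using Finset.induction_on with
  | empty => intro ε hε; simp [hε.le]
  | insert a s ha ih =>
    simp only [Finset.sum_insert ha]
    exact (h a (by simp)).add (ih fun b hb => h b (by simp [hb]))

theorem unifClose_grid (n : ℕ → ℕ) (f : ℝ → ℝ) :
    UnifClose n (fun i k => f ((k : ℝ) / n i)) f := by
  intro ε hε
  simp [hε.le]

theorem UnifClose.congr {n : ℕ → ℕ} {F : ℕ → ℕ → ℝ} {f g : ℝ → ℝ} (hF : UnifClose n F f)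
    (h : EqOn f g (Icc 0 1)) : UnifClose n F g := by
  intro ε hε
  filter_upwards [hF ε hε] with i hi k hk
  rw [← h (div_mem_Icc hk)]
  exact hi k hk

/-! ### Sums on the grid and integrals -/

theorem sumUpTo_succ (n : ℕ) (f : ℕ → ℝ) (k : ℕ) :
    sumUpTo n f (k + 1) = sumUpTo n f k + f k / n := by
  simp [sumUpTo, Finset.sum_range_succ, add_div]

theorem sumUpTo_add (n : ℕ) (f g : ℕ → ℝ) (k : ℕ) :
    sumUpTo n (fun j => f j + g j) k = sumUpTo n f k + sumUpTo n g k := by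
  simp [sumUpTo, Finset.sum_add_distrib, add_div]

theorem sumUpTo_sub (n : ℕ) (f g : ℕ → ℝ) (k : ℕ) :
    sumUpTo n (fun j => f j - g j) k = sumUpTo n f k - sumUpTo n g k := by
  simp [sumUpTo, Finset.sum_sub_distrib, sub_div]

theorem intervalIntegrable_of_Icc {f : ℝ → ℝ} (hf : ContinuousOn f (Icc 0 1)) {a b : ℝ}
    (ha : a ∈ Icc (0 : ℝ) 1) (hb : b ∈ Icc (0 : ℝ) 1) :
    IntervalIntegrable f MeasureTheory.volume a b :=
  (hf.mono (uIcc_subset_Icc ha hb)).intervalIntegrable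

theorem primitive_sub {f : ℝ → ℝ} (hf : ContinuousOn f (Icc 0 1)) {a b : ℝ}
    (ha : a ∈ Icc (0 : ℝ) 1) (hb : b ∈ Icc (0 : ℝ) 1) :
    primitive f b - primitive f a = ∫ τ in a..b, f τ :=
  intervalIntegral.integral_interval_sub_left
    (intervalIntegrable_of_Icc hf (by simp) hb) (intervalIntegrable_of_Icc hf (by simp) ha)

theorem primitive_zero (f : ℝ → ℝ) : primitive f 0 = 0 := by simp [primitive]

theorem continuousOn_primitive {f : ℝ → ℝ} (hf : ContinuousOn f (Icc 0 1)) :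
    ContinuousOn (primitive f) (Icc 0 1) := by
  have h := intervalIntegral.continuousOn_primitive_interval (μ := MeasureTheory.volume)
    (f := f) (a := 0) (b := 1)
    (by rw [uIcc_of_le zero_le_one]; exact hf.integrableOn_Icc)
  rwa [uIcc_of_le zero_le_one] at h

theorem continuousOn_primitive_iterate {f : ℝ → ℝ} (hf : ContinuousOn f (Icc 0 1)) (k : ℕ) :
    ContinuousOn (primitive^[k] f) (Icc 0 1) := by
  induction k with
  | zero => exact hf
  | succ k ih => rw [Function.iterate_succ_apply']; exact continuousOn_primitive ih

theorem primitive_congr {f g : ℝ → ℝ} (h : EqOn f g (Icc 0 1)) :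
    EqOn (primitive f) (primitive g) (Icc 0 1) := fun _ ht =>
  intervalIntegral.integral_congr (h.mono (uIcc_subset_Icc (by simp) ht))

theorem UnifClose.sumUpTo {n : ℕ → ℕ} {F : ℕ → ℕ → ℝ} {f : ℝ → ℝ}
    (hn : Tendsto n (hyperfilter ℕ) atTop) (hf : ContinuousOn f (Icc 0 1))
    (hF : UnifClose n F f) :
    UnifClose n (fun i => sumUpTo (n i) (F i)) (primitive f) := by
  intro ε hε
  obtain ⟨δ, hδ, huc⟩ := Metric.uniformContinuousOn_iff_le.1
    (isCompact_Icc.uniformContinuousOn_of_continuous hf) (ε / 2) (by positivity)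
  have hsmall : ∀ᶠ i in hyperfilter ℕ, (1 : ℝ) / n i < δ ∧ 0 < n i := by
    have h0 : Tendsto (fun i => (1 : ℝ) / n i) (hyperfilter ℕ) (𝓝 0) :=
      tendsto_one_div_atTop_nhds_zero_nat.comp hn
    exact (h0.eventually_lt_const hδ).and (hn.eventually_gt_atTop 0)
  filter_upwards [hF (ε / 2) (by positivity), hsmall] with i hi ⟨hi1, hi0⟩ k hk
  have hn0 : (0 : ℝ) < n i := by exact_mod_cast hi0
  -- A bound proportional to elapsed time is what the induction on `k` can carry: each cell of
  -- length `1 / n` adds at most `ε / n`.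
  suffices h : |BurstNoise.sumUpTo (n i) (F i) k - primitive f (k / n i)| ≤ k / n i * ε from
    h.trans (mul_le_of_le_one_left hε.le (div_mem_Icc hk).2)
  induction k with
  | zero => simp [BurstNoise.sumUpTo, primitive]
  | succ k ih =>
    have hk' : k ≤ n i := by omega
    have ha := div_mem_Icc hk'
    have hb := div_mem_Icc hk
    have hab : ((k + 1 : ℕ) : ℝ) / n i - k / n i = 1 / n i := by push_cast; ring
    have hle : (k : ℝ) / n i ≤ ((k + 1 : ℕ) : ℝ) / n i := by
      have : (0 : ℝ) < 1 / n i := by positivity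
      linarith
    have hstep : |F i k / n i - ∫ τ in ((k : ℝ) / n i)..(((k + 1 : ℕ) : ℝ) / n i), f τ| ≤
        ε * (1 / n i) := by
      have hc : F i k / n i =
          ∫ _ in ((k : ℝ) / n i)..(((k + 1 : ℕ) : ℝ) / n i), F i k := by
        rw [intervalIntegral.integral_const, hab, smul_eq_mul]; ring
      rw [hc, ← intervalIntegral.integral_sub (by simp) (intervalIntegrable_of_Icc hf ha hb)]
      have := intervalIntegral.norm_integral_le_of_norm_le_const
        (f := fun τ => F i k - f τ) (a := (k : ℝ) / n i) (b := ((k + 1 : ℕ) : ℝ) / n i) (C := ε)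
        (fun τ hτ => by
          rw [uIoc_of_le hle] at hτ
          have h1 := hi k hk'
          have h2 := huc (k / n i) ha τ ⟨ha.1.trans hτ.1.le, hτ.2.trans hb.2⟩ (by
            rw [Real.dist_eq, abs_sub_comm, abs_of_nonneg (by linarith [hτ.1])]
            linarith [hτ.2])
          rw [Real.dist_eq] at h2
          calc ‖F i k - f τ‖ ≤ |F i k - f (k / n i)| + |f (k / n i) - f τ| :=
                abs_sub_le _ _ _
            _ ≤ ε := by linarith)
      rwa [hab, abs_of_pos (by positivity : (0 : ℝ) < 1 / n i)] at this
    have hsplit : BurstNoise.sumUpTo (n i) (F i) (k + 1) - primitive f (((k + 1 : ℕ) : ℝ) / n i) =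
        (BurstNoise.sumUpTo (n i) (F i) k - primitive f (k / n i)) +
          (F i k / n i - ∫ τ in ((k : ℝ) / n i)..(((k + 1 : ℕ) : ℝ) / n i), f τ) := by
      rw [sumUpTo_succ, ← primitive_sub hf ha hb]; ring
    rw [hsplit]
    calc _ ≤ _ := abs_add_le _ _
      _ ≤ k / n i * ε + ε * (1 / n i) := add_le_add (ih hk') hstep
      _ = _ := by push_cast; ring

/-- Abel summation: a monotone weight with values in `[0, 1]` keeps cumulative sums small. -/
theorem abs_sumUpTo_mul_le {n : ℕ} {w g : ℕ → ℝ} {ε : ℝ} (hw : Monotone w)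
    (hw0 : 0 ≤ w 0) (hg : ∀ k ≤ n, |sumUpTo n g k| ≤ ε) (k : ℕ) (hk : k ≤ n) (hw1 : w k ≤ 1) :
    |sumUpTo n (fun j => w j * g j) k| ≤ 2 * ε := by
  have hε : 0 ≤ ε := (abs_nonneg _).trans (hg 0 (Nat.zero_le n))
  -- The remainder of summation by parts is bounded by the variation of `w` times `ε`.
  have key : ∀ k ≤ n, |sumUpTo n (fun j => w j * g j) k - w k * sumUpTo n g k| ≤
      (w k - w 0) * ε := by
    intro k
    induction k with
    | zero => simp [sumUpTo]
    | succ k ih =>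
      intro hk
      have h1 := ih (by omega)
      have h2 := hg (k + 1) hk
      have hwk : 0 ≤ w (k + 1) - w k := sub_nonneg.2 (hw k.le_succ)
      have hsplit : sumUpTo n (fun j => w j * g j) (k + 1) - w (k + 1) * sumUpTo n g (k + 1) =
          (sumUpTo n (fun j => w j * g j) k - w k * sumUpTo n g k) -
            (w (k + 1) - w k) * sumUpTo n g (k + 1) := by
        rw [sumUpTo_succ, sumUpTo_succ]; ring
      rw [hsplit]
      calc _ ≤ _ := abs_sub _ _
        _ ≤ (w k - w 0) * ε + (w (k + 1) - w k) * ε := by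
          rw [abs_mul, abs_of_nonneg hwk]
          gcongr
        _ = _ := by ring
  have hwk0 : 0 ≤ w k := hw0.trans (hw k.zero_le)
  calc |sumUpTo n (fun j => w j * g j) k|
      ≤ |sumUpTo n (fun j => w j * g j) k - w k * sumUpTo n g k| + |w k * sumUpTo n g k| := by
        simpa using abs_add_le (sumUpTo n (fun j => w j * g j) k - w k * sumUpTo n g k)
          (w k * sumUpTo n g k)
    _ ≤ 1 * ε + 1 * ε := by
        rw [abs_mul, abs_of_nonneg hwk0]
        refine add_le_add ((key k hk).trans ?_) ?_
        · gcongr; linarith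
        · exact mul_le_mul hw1 (hg k hk) (abs_nonneg _) zero_le_one
    _ = 2 * ε := by ring

/-- Only the cumulative sums of `F` are controlled, not its values. Subtracting `f` on the grid
leaves small cumulative sums, to which Abel summation applies with the monotone weight `τ ^ ν`; the
part with `f` is a Riemann sum. -/
theorem UnifClose.sumUpTo_pow_mul {n : ℕ → ℕ} {F : ℕ → ℕ → ℝ} {f : ℝ → ℝ}
    (hn : Tendsto n (hyperfilter ℕ) atTop) (hf : ContinuousOn f (Icc 0 1))
    (hF : UnifClose n (fun i => BurstNoise.sumUpTo (n i) (F i)) (primitive f)) (ν : ℕ) :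
    UnifClose n (fun i => BurstNoise.sumUpTo (n i) fun j => ((j : ℝ) / n i) ^ ν * F i j)
      (primitive fun τ => τ ^ ν * f τ) := by
  have hcν : ContinuousOn (fun τ : ℝ => τ ^ ν * f τ) (Icc 0 1) := by fun_prop
  have h1 := UnifClose.sumUpTo hn hcν (unifClose_grid n fun τ => τ ^ ν * f τ)
  have h2 := hF.sub (UnifClose.sumUpTo hn hf (unifClose_grid n f))
  have h3 : UnifClose n (fun i => BurstNoise.sumUpTo (n i) fun j =>
      ((j : ℝ) / n i) ^ ν * (F i j - f ((j : ℝ) / n i))) (fun _ => 0) := by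
    intro ε hε
    filter_upwards [h2 (ε / 2) (by positivity)] with i hi k hk
    have := abs_sumUpTo_mul_le (n := n i) (w := fun j : ℕ => ((j : ℝ) / n i) ^ ν)
      (g := fun j => F i j - f ((j : ℝ) / n i)) (ε := ε / 2)
      (fun a b hab => by dsimp only; gcongr) (by positivity)
      (fun k hk => by rw [sumUpTo_sub]; simpa using hi k hk) k hk
      (pow_le_one₀ (by positivity) (div_mem_Icc hk).2)
    rw [sub_zero]
    linarith
  have h4 := h3.add h1
  simp only [zero_add, ← sumUpTo_add] at h4
  convert h4 using 5
  ring

theorem UnifClose.sumUpTo_iterate {n : ℕ → ℕ} {F : ℕ → ℕ → ℝ} {f : ℝ → ℝ}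
    (hn : Tendsto n (hyperfilter ℕ) atTop) (hf : ContinuousOn f (Icc 0 1))
    (hF : UnifClose n (fun i => BurstNoise.sumUpTo (n i) (F i)) (primitive f)) (k : ℕ) :
    UnifClose n (fun i => (BurstNoise.sumUpTo (n i))^[k + 1] (F i)) (primitive^[k + 1] f) := by
  induction k with
  | zero => exact hF
  | succ k ih =>
    simp only [Function.iterate_succ_apply' _ (k + 1)]
    exact UnifClose.sumUpTo hn (continuousOn_primitive_iterate hf _) ih

theorem IntegralForm.unifClose_gridLin (E : IntegralForm) {n : ℕ → ℕ} {F : ℕ → ℕ → ℝ} {f : ℝ → ℝ}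
    (hn : Tendsto n (hyperfilter ℕ) atTop) (hf : ContinuousOn f (Icc 0 1))
    (hF : UnifClose n (fun i => sumUpTo (n i) (F i)) (primitive f)) :
    UnifClose n (fun i => E.gridLin (n i) (F i)) (E.lin f) := by
  refine UnifClose.sum E.coeff.support fun a _ => UnifClose.const_mul ?_ _
  exact UnifClose.sumUpTo_iterate hn (by fun_prop) (hF.sumUpTo_pow_mul hn hf a.2) a.1

/-! ### Cumulative integrals of a noise -/

/-- The initial segment `{0, 1/N, …, (K-1)/N}` of the grid. -/
def initialSegment (K : Hypernat) : InternalSet := Germ.map (fun k => {j : ℕ | j < k}) K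

theorem sumUpTo_indicator_Iio {n k : ℕ} (h : k ≤ n) (f : ℕ → ℝ) :
    sumUpTo n ({j : ℕ | j < k}.indicator f) n = sumUpTo n f k := by
  classical
  unfold sumUpTo
  congr 1
  have hr : ∀ a : ℕ, {j : ℕ | j < k}.indicator f a = if a ∈ Finset.range k then f a else 0 := by
    intro a; simp [Set.indicator]
  simp_rw [hr]
  rw [Finset.sum_ite_mem, Finset.inter_eq_right.2 (Finset.range_mono h)]

/-- The boundary lies in the halo of the cut `K / N`, hence in every standard-size interval around
it. -/
theorem quadrable_initialSegment {N K : Hypernat} (hN : Unlimited N) :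
    Quadrable N (initialSegment K) := by
  induction N using Germ.inductionOn with | _ n
  induction K using Germ.inductionOn with | _ k
  have hn := hN.tendsto
  intro ε hε
  -- Half-width `ε / 4` gives at most `2 (ε / 4) n + 1` points, which is at most `ε n` once `n ≥ 4 /
  -- ε`.
  refine ⟨((fun i => {j : ℕ | |(j : ℝ) / n i - k i / n i| ≤ ε / 4}) : ℕ → Set ℕ), ?_, ?_⟩
  · rintro J ⟨-, ⟨L, -, hLJ, hL⟩, ⟨M, -, hMJ, hM⟩⟩
    induction J using Germ.inductionOn with | _ j
    induction L using Germ.inductionOn with | _ l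
    induction M using Germ.inductionOn with | _ m
    have hL' : ∀ᶠ i in hyperfilter ℕ, l i < k i := hL
    have hM' : ∀ᶠ i in hyperfilter ℕ, ¬ m i < k i := Ultrafilter.eventually_not.2 hM
    have h1 := near_ofSeq.1 hLJ (ε / 4) (by positivity)
    have h2 := near_ofSeq.1 hMJ (ε / 4) (by positivity)
    change ∀ᶠ i in hyperfilter ℕ, |(j i : ℝ) / n i - k i / n i| ≤ ε / 4
    filter_upwards [hL', hM', h1, h2] with i hl hm h1 h2
    have h3 : (l i : ℝ) / n i ≤ k i / n i := by gcongr
    have h4 : (k i : ℝ) / n i ≤ m i / n i := by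
      have := not_lt.1 hm
      gcongr
    rw [abs_lt] at h1 h2
    exact abs_le.2 ⟨by linarith, by linarith⟩
  · change Hyperreal.ofSeq (fun i => sumUpTo (n i)
      ({j : ℕ | |(j : ℝ) / n i - k i / n i| ≤ ε / 4}.indicator 1) (n i)) ≤
        Hyperreal.ofSeq fun _ => ε
    refine Hyperreal.ofSeq_le_ofSeq.2 ?_
    have hbig : ∀ᶠ i in hyperfilter ℕ, 4 / ε ≤ (n i : ℝ) :=
      (tendsto_natCast_atTop_atTop.comp hn).eventually_ge_atTop _
    filter_upwards [hbig, hn.eventually_gt_atTop 0] with i hi hi0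
    have hn0 : (0 : ℝ) < n i := by exact_mod_cast hi0
    classical
    set S := (Finset.range (n i)).filter fun j : ℕ => |(j : ℝ) / n i - k i / n i| ≤ ε / 4 with hS
    have hsum : sumUpTo (n i) ({j : ℕ | |(j : ℝ) / n i - k i / n i| ≤ ε / 4}.indicator 1) (n i) =
        S.card / n i := by
      simp [sumUpTo, Set.indicator, hS]
    rw [hsum, div_le_iff₀ hn0]
    have hr : ∀ j ∈ S, |(j : ℝ) - k i| ≤ ε / 4 * n i := by
      intro j hj
      have := (Finset.mem_filter.1 hj).2
      rwa [← sub_div, abs_div, abs_of_pos hn0, div_le_iff₀ hn0] at this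
    set r := ⌊ε / 4 * n i⌋₊ with hr'
    have hsub : S ⊆ Finset.Icc (k i - r) (k i + r) := by
      intro j hj
      have h := abs_le.1 (hr j hj)
      have hpos : 0 ≤ ε / 4 * n i := by positivity
      rw [Finset.mem_Icc]
      constructor
      · rcases le_total (k i) j with h' | h'
        · omega
        · have : k i - j ≤ r := Nat.le_floor (by push_cast [h']; linarith)
          omega
      · rcases le_total j (k i) with h' | h'
        · omega
        · have : j - k i ≤ r := Nat.le_floor (by push_cast [h']; linarith)
          omega
    have hcard : S.card ≤ 2 * r + 1 := by
      refine (Finset.card_le_card hsub).trans ?_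
      rw [Nat.card_Icc]; omega
    have hfl : (r : ℝ) ≤ ε / 4 * n i := Nat.floor_le (by positivity)
    have hone : 1 ≤ ε / 4 * n i := by
      have := mul_le_mul_of_nonneg_left hi (by positivity : 0 ≤ ε / 4)
      have h1 : ε / 4 * (4 / ε) = 1 := by field_simp
      linarith
    have : (S.card : ℝ) ≤ 2 * r + 1 := by exact_mod_cast hcard
    nlinarith

theorem FastOscillating.unifClose_sumUpTo {n : ℕ → ℕ} {F : ℕ → ℕ → ℝ}
    (hN : Unlimited (n : Hypernat)) (h : FastOscillating (n : Hypernat) (F : InternalFun)) :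
    UnifClose n (fun i => sumUpTo (n i) (F i)) (fun _ => 0) := by
  refine unifClose_of_forall fun k hk => ?_
  have h1 := h.2 _ (quadrable_initialSegment (K := (k : Hypernat)) hN)
  have h2 : Tendsto (fun i => sumUpTo (n i) ({j : ℕ | j < k i}.indicator (F i)) (n i))
      (hyperfilter ℕ) (𝓝 0) := near_ofSeq_zero.1 h1
  refine h2.congr' ?_
  filter_upwards [hk] with i hi
  rw [sumUpTo_indicator_Iio hi, sub_zero]

/-- The cumulative integral of a noise whose mean has a continuous shadow. -/
theorem IsNoise.unifClose_sumUpTo {n : ℕ → ℕ} {m F : ℕ → ℕ → ℝ} {p : ℝ → ℝ}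
    (hN : Unlimited (n : Hypernat)) (hp : ContinuousOn p (Icc 0 1))
    (hm : HasShadow (n : Hypernat) (m : InternalFun) p)
    (h : IsNoise (n : Hypernat) (m : InternalFun) (F : InternalFun)) :
    UnifClose n (fun i => sumUpTo (n i) (F i)) (primitive p) := by
  have h1 : UnifClose n (fun i => sumUpTo (n i) fun j => F i j - m i j) (fun _ => 0) :=
    FastOscillating.unifClose_sumUpTo (F := fun i j => F i j - m i j) hN h.2.2
  have h2 := h1.add (((hasShadow_coe_iff hp).1 hm).sumUpTo hN.tendsto hp)
  simpa only [← sumUpTo_add, sub_add_cancel, zero_add] using h2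

/-! ### Primitives on `[0, 1]` -/

theorem hasDerivWithinAt_primitive {f : ℝ → ℝ} (hf : ContinuousOn f (Icc 0 1)) {t : ℝ}
    (ht : t ∈ Icc (0 : ℝ) 1) : HasDerivWithinAt (primitive f) (f t) (Icc 0 1) t := by
  -- A continuous extension to the line makes the two-sided fundamental theorem available at the
  -- endpoints too.
  set g : ℝ → ℝ := IccExtend zero_le_one ((Icc (0 : ℝ) 1).domRestrict f) with hg
  have hgc : Continuous g := (continuousOn_iff_continuous_domRestrict.1 hf).Icc_extend'
  have hfg : EqOn f g (Icc 0 1) := fun x hx => by rw [hg, IccExtend_of_mem _ _ hx]; rfl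
  have h1 : HasDerivAt (primitive g) (g t) t :=
    intervalIntegral.integral_hasDerivAt_right (hgc.intervalIntegrable _ _)
      hgc.aestronglyMeasurable.stronglyMeasurableAtFilter hgc.continuousAt
  rw [hfg ht]
  exact h1.hasDerivWithinAt.congr (fun x hx => primitive_congr hfg hx) (primitive_congr hfg ht)

theorem eqOn_primitive_of_hasDerivWithinAt {f g : ℝ → ℝ} (hf : ContinuousOn f (Icc 0 1))
    (hg : ∀ t ∈ Icc (0 : ℝ) 1, HasDerivWithinAt g (f t) (Icc 0 1) t) (h0 : g 0 = 0) :
    EqOn (primitive f) g (Icc 0 1) := by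
  intro t ht
  have h := (convex_Icc (0 : ℝ) 1).is_const_of_fderivWithin_eq_zero (𝕜 := ℝ)
    (f := fun x => primitive f x - g x)
    (fun x hx => ((hasDerivWithinAt_primitive hf hx).sub (hg x hx)).differentiableWithinAt)
    (fun x hx => by
      have := ((hasDerivWithinAt_primitive hf hx).sub (hg x hx))
      rw [sub_self] at this
      have h2 := this.hasFDerivWithinAt.fderivWithin (uniqueDiffOn_Icc zero_lt_one x hx)
      refine h2.trans ?_
      ext; simp)
    ht (y := 0) (by simp)
  simp only [primitive_zero, h0, sub_self] at h
  linarith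

theorem primitive_add {f g : ℝ → ℝ} (hf : ContinuousOn f (Icc 0 1))
    (hg : ContinuousOn g (Icc 0 1)) {t : ℝ} (ht : t ∈ Icc (0 : ℝ) 1) :
    primitive (fun τ => f τ + g τ) t = primitive f t + primitive g t :=
  intervalIntegral.integral_add (intervalIntegrable_of_Icc hf (by simp) ht)
    (intervalIntegrable_of_Icc hg (by simp) ht)

theorem primitive_const_mul (c : ℝ) (f : ℝ → ℝ) (t : ℝ) :
    primitive (fun τ => c * f τ) t = c * primitive f t :=
  intervalIntegral.integral_const_mul _ _

theorem primitive_sum {ι : Type*} (s : Finset ι) {f : ι → ℝ → ℝ}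
    (hf : ∀ a ∈ s, ContinuousOn (f a) (Icc 0 1)) {t : ℝ} (ht : t ∈ Icc (0 : ℝ) 1) :
    primitive (fun τ => ∑ a ∈ s, f a τ) t = ∑ a ∈ s, primitive (f a) t :=
  intervalIntegral.integral_finsetSum
    fun a ha => intervalIntegrable_of_Icc (hf a ha) (by simp) ht

/-- Integration by parts against the identity function. -/
theorem mul_primitive {f : ℝ → ℝ} (hf : ContinuousOn f (Icc 0 1)) {t : ℝ}
    (ht : t ∈ Icc (0 : ℝ) 1) :
    t * primitive f t = primitive (fun τ => τ * f τ) t + primitive (primitive f) t := by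
  have hc : ContinuousOn (primitive f) (Icc 0 1) := continuousOn_primitive hf
  have h1 := eqOn_primitive_of_hasDerivWithinAt (f := fun τ => τ * f τ + primitive f τ)
    (g := fun τ => τ * primitive f τ) (by fun_prop)
    (fun x hx => by
      have := (hasDerivWithinAt_id x (Icc 0 1)).mul (hasDerivWithinAt_primitive hf hx)
      simpa [add_comm] using! this) (by simp) ht
  rw [← primitive_add (by fun_prop) hc ht, h1]

/-- The commutator of `t` with the `k`-fold integral is `k` times the `(k + 1)`-fold one, by
repeated integration by parts. -/
theorem mul_primitive_iterate {f : ℝ → ℝ} (hf : ContinuousOn f (Icc 0 1)) (k : ℕ) :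
    EqOn (fun t => t * primitive^[k] f t)
      (fun t => primitive^[k] (fun τ => τ * f τ) t + k * primitive^[k + 1] f t) (Icc 0 1) := by
  have hf' : ContinuousOn (fun τ => τ * f τ) (Icc 0 1) := by fun_prop
  induction k with
  | zero => intro t _; simp
  | succ k ih =>
    intro t ht
    have hc := continuousOn_primitive_iterate hf k
    have hc' := continuousOn_primitive_iterate hf (k + 1)
    have hc2 := continuousOn_primitive_iterate hf' k
    simp only [Function.iterate_succ_apply' _ (k + 1)]
    rw [Function.iterate_succ_apply', mul_primitive hc ht, primitive_congr ih ht,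
      primitive_add hc2 (by fun_prop) ht, primitive_const_mul]
    simp only [Function.iterate_succ_apply']
    push_cast
    ring

/-! ### Analyticity of primitives -/

/-- The primitive of an analytic function is analytic. -/
theorem analyticAt_integral {g : ℝ → ℝ} {t₀ : ℝ} (hg : AnalyticAt ℝ g t₀) :
    AnalyticAt ℝ (fun t => ∫ τ in t₀..t, g τ) t₀ := by
  obtain ⟨p, hp⟩ := hg
  obtain ⟨r, hr0, hr⟩ := Metric.eventually_nhds_iff.1 (hasFPowerSeriesAt_iff.1 hp)
  -- Coefficients of the termwise integrated series; at `n = 0` division by zero gives the constant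
  -- term `0`.
  let q : ℕ → ℝ := fun n => p.coeff (n - 1) / n
  refine ⟨FormalMultilinearSeries.ofScalars ℝ q, hasFPowerSeriesAt_iff.2 ?_⟩
  filter_upwards [Metric.ball_mem_nhds (0 : ℝ) (half_pos hr0)] with z hz
  have hz' : |z| < r / 2 := by simpa using hz
  have hsum : Summable fun n => ‖(r / 2) ^ n • p.coeff n‖ := by
    have h := (hr (y := r / 2) (by
      rw [dist_zero_right, Real.norm_eq_abs, abs_of_pos (half_pos hr0)]; linarith)).summable
    exact h.abs
  have hmain : HasSum (fun n => ∫ w in (0 : ℝ)..z, w ^ n • p.coeff n)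
      (∫ w in (0 : ℝ)..z, g (t₀ + w)) := by
    have hw : ∀ w ∈ uIoc 0 z, |w| ≤ r / 2 := by
      intro w hw
      have := abs_sub_left_of_mem_uIcc (uIoc_subset_uIcc hw)
      simp only [sub_zero] at this
      linarith
    refine intervalIntegral.hasSum_integral_of_dominated_convergence
      (fun n _ => ‖(r / 2) ^ n • p.coeff n‖) (fun n => ?_) (fun n => ?_) ?_ ?_ ?_
    · exact Continuous.aestronglyMeasurable (by fun_prop)
    · refine Eventually.of_forall fun w hw' => ?_
      rw [norm_smul, norm_smul, norm_pow, norm_pow]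
      gcongr
      rw [Real.norm_eq_abs, Real.norm_eq_abs, abs_of_pos (half_pos hr0)]
      exact hw w hw'
    · exact Eventually.of_forall fun _ _ => hsum
    · exact intervalIntegrable_const
    · refine Eventually.of_forall fun w hw' => hr ?_
      rw [dist_zero_right, Real.norm_eq_abs]
      linarith [hw w hw']
  have hint : ∀ n : ℕ, ∫ w in (0 : ℝ)..z, w ^ n • p.coeff n = z ^ (n + 1) • q (n + 1) := by
    intro n
    simp only [smul_eq_mul, q, Nat.add_sub_cancel]
    rw [intervalIntegral.integral_mul_const, integral_pow]
    push_cast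
    simp
    ring
  simp only [FormalMultilinearSeries.coeff_ofScalars]
  simp_rw [hint] at hmain
  have hshift : ∫ w in (0 : ℝ)..z, g (t₀ + w) = ∫ τ in t₀..(t₀ + z), g τ := by
    simp
  rw [hshift] at hmain
  have := (hasSum_nat_add_iff (f := fun n => z ^ n • q n) 1).1 hmain
  simpa [q] using this

theorem analyticOn_primitive {f : ℝ → ℝ} (hf : AnalyticOn ℝ f (Icc 0 1)) :
    AnalyticOn ℝ (primitive f) (Icc 0 1) := by
  intro t₀ ht₀
  -- `g` equals `f` on all of `[0, 1]` and is analytic at `t₀`, so the integrals agree without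
  -- shrinking the interval.
  obtain ⟨g, -, hfg, hg⟩ := (hf t₀ ht₀).exists_analyticAt
  rw [insert_eq_of_mem ht₀] at hfg
  refine analyticWithinAt_iff_exists_analyticAt'.2
    ⟨fun t => primitive f t₀ + ∫ τ in t₀..t, g τ, by simp, ?_,
      analyticAt_const.add (analyticAt_integral hg)⟩
  rw [insert_eq_of_mem ht₀]
  intro t ht
  have h := primitive_sub hf.continuousOn ht₀ ht
  rw [intervalIntegral.integral_congr (hfg.mono (uIcc_subset_Icc ht₀ ht))] at h
  dsimp only
  linarith

theorem analyticOn_primitive_iterate {f : ℝ → ℝ} (hf : AnalyticOn ℝ f (Icc 0 1)) (k : ℕ) :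
    AnalyticOn ℝ (primitive^[k] f) (Icc 0 1) := by
  induction k with
  | zero => exact hf
  | succ k ih => rw [Function.iterate_succ_apply']; exact analyticOn_primitive ih

/-! ### Integral forms on standard signals -/

namespace IntegralForm

theorem lin_eq_sum (E : IntegralForm) (u : ℝ → ℝ) :
    E.lin u = fun t => ∑ i ∈ E.coeff.support,
      E.coeff i * (primitive^[i.1 + 1] fun τ => τ ^ i.2 * u τ) t := rfl

theorem continuousOn_lin (E : IntegralForm) {u : ℝ → ℝ} (hu : ContinuousOn u (Icc 0 1)) :
    ContinuousOn (E.lin u) (Icc 0 1) := by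
  rw [lin_eq_sum]
  exact continuousOn_finsetSum _ fun i _ => continuousOn_const.mul
    (continuousOn_primitive_iterate (by fun_prop) _)

theorem analyticOn_lin (E : IntegralForm) {u : ℝ → ℝ} (hu : AnalyticOn ℝ u (Icc 0 1)) :
    AnalyticOn ℝ (E.lin u) (Icc 0 1) := by
  rw [lin_eq_sum]
  exact Finset.analyticOn_fun_sum _ fun i _ => analyticOn_const.mul
    (analyticOn_primitive_iterate (((analyticOn_id).pow _).mul hu) _)

theorem analyticOn_std (E : IntegralForm) {u : ℝ → ℝ} (hu : AnalyticOn ℝ u (Icc 0 1)) :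
    AnalyticOn ℝ (E.std u) (Icc 0 1) :=
  E.known_analytic.add (E.analyticOn_lin hu)

theorem lin_zero (E : IntegralForm) (u : ℝ → ℝ) : E.lin u 0 = 0 := by
  simp [lin, Finsupp.sum, Function.iterate_succ_apply', primitive_zero]

theorem std_zero (E : IntegralForm) (u : ℝ → ℝ) : E.std u 0 = 0 := by
  simp [std, E.known_zero, lin_zero]

theorem lin_add (E : IntegralForm) {u v : ℝ → ℝ} (hu : ContinuousOn u (Icc 0 1))
    (hv : ContinuousOn v (Icc 0 1)) :
    EqOn (E.lin fun τ => u τ + v τ) (fun t => E.lin u t + E.lin v t) (Icc 0 1) := by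
  have key : ∀ (k : ℕ) {u v : ℝ → ℝ}, ContinuousOn u (Icc 0 1) → ContinuousOn v (Icc 0 1) →
      EqOn (primitive^[k] fun τ => u τ + v τ) (fun t => primitive^[k] u t + primitive^[k] v t)
        (Icc 0 1) := by
    intro k u v hu hv
    induction k with
    | zero => intro t _; rfl
    | succ k ih =>
      intro t ht
      simp only [Function.iterate_succ_apply']
      rw [primitive_congr ih ht, primitive_add (continuousOn_primitive_iterate hu k)
        (continuousOn_primitive_iterate hv k) ht]
  intro t ht
  simp only [lin_eq_sum, ← Finset.sum_add_distrib, ← mul_add]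
  refine Finset.sum_congr rfl fun i _ => ?_
  have h := key (i.1 + 1) (u := fun τ => τ ^ i.2 * u τ) (v := fun τ => τ ^ i.2 * v τ)
    (by fun_prop) (by fun_prop) ht
  simp only [← mul_add] at h
  rw [h]

/-- The expression `t ↦ t E(t) - (j + 1) ∫_0^t E`, an operator which annihilates `t ↦ t ^ j`. -/
def step (E : IntegralForm) (j : ℕ) : IntegralForm where
  known t := t * E.known t - (j + 1) * primitive E.known t
  known_analytic := (analyticOn_id.mul E.known_analytic).sub
    (analyticOn_const.mul (analyticOn_primitive E.known_analytic))
  known_zero := by simp [primitive_zero]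
  -- The factor `i.1 - j` is `i.1 + 1` from moving `t` inside `i.1 + 1` integrals, minus the `j + 1`
  -- of the subtracted primitive.
  coeff := E.coeff.sum fun i c =>
    Finsupp.single (i.1, i.2 + 1) c + Finsupp.single (i.1 + 1, i.2) (c * (i.1 - j))

theorem lin_step (E : IntegralForm) (j : ℕ) {u : ℝ → ℝ} (hu : ContinuousOn u (Icc 0 1)) {t : ℝ}
    (ht : t ∈ Icc (0 : ℝ) 1) :
    (E.step j).lin u t = t * E.lin u t - (j + 1) * primitive (E.lin u) t := by
  have h1 : (E.step j).lin u t = E.coeff.sum fun i c =>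
      c * (primitive^[i.1 + 1] fun τ => τ ^ (i.2 + 1) * u τ) t +
        c * (i.1 - j) * (primitive^[i.1 + 2] fun τ => τ ^ i.2 * u τ) t := by
    unfold lin step
    dsimp only
    rw [Finsupp.sum_sum_index (by simp) (by intros; ring)]
    refine Finsupp.sum_congr fun i _ => ?_
    rw [Finsupp.sum_add_index' (by simp) (by intros; ring), Finsupp.sum_single_index (by simp),
      Finsupp.sum_single_index (by simp)]
  have h2 : primitive (E.lin u) t = ∑ i ∈ E.coeff.support,
      E.coeff i * (primitive^[i.1 + 2] fun τ => τ ^ i.2 * u τ) t := by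
    rw [lin_eq_sum, primitive_sum
      (f := fun i t => E.coeff i * (primitive^[i.1 + 1] fun τ => τ ^ i.2 * u τ) t) _
      (fun i _ => continuousOn_const.mul (continuousOn_primitive_iterate (by fun_prop) _)) ht]
    simp only [primitive_const_mul, Function.iterate_succ_apply' primitive (_ + 1)]
  rw [h1, h2, lin_eq_sum, Finsupp.sum, Finset.mul_sum, Finset.mul_sum, ← Finset.sum_sub_distrib]
  refine Finset.sum_congr rfl fun i _ => ?_
  have h3 := mul_primitive_iterate (f := fun τ => τ ^ i.2 * u τ) (by fun_prop) (i.1 + 1) ht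
  have h4 : (fun τ => τ * (τ ^ i.2 * u τ)) = fun τ => τ ^ (i.2 + 1) * u τ := by
    ext τ; ring
  dsimp only at h3
  rw [h4] at h3
  push_cast at h3
  linear_combination E.coeff i * (-h3)

theorem std_step (E : IntegralForm) (j : ℕ) {u : ℝ → ℝ} (hu : ContinuousOn u (Icc 0 1)) {t : ℝ}
    (ht : t ∈ Icc (0 : ℝ) 1) :
    (E.step j).std u t = t * E.std u t - (j + 1) * primitive (E.std u) t := by
  have h : primitive (E.std u) t = primitive E.known t + primitive (E.lin u) t :=
    primitive_add E.known_analytic.continuousOn (E.continuousOn_lin hu) ht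
  rw [h, std, std, E.lin_step j hu ht]
  simp only [step]
  ring

end IntegralForm

/-! ### Functions annihilated by a power of the derivative -/

theorem AnnihilatedByPower.of_derivWithin {f g : ℝ → ℝ}
    (hg : EqOn g (derivWithin f (Icc 0 1)) (Icc 0 1)) (h : AnnihilatedByPower g) :
    AnnihilatedByPower f := by
  obtain ⟨M, hM⟩ := h
  refine ⟨M + 1, fun t ht => ?_⟩
  rw [iteratedDerivWithin_succ', ← iteratedDerivWithin_congr hg ht]
  exact hM t ht

theorem iteratedDerivWithin_eq_zero_of_le {f : ℝ → ℝ} {M M' : ℕ} (hM : M ≤ M')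
    (h : ∀ t ∈ Icc (0 : ℝ) 1, iteratedDerivWithin M f (Icc 0 1) t = 0) :
    ∀ t ∈ Icc (0 : ℝ) 1, iteratedDerivWithin M' f (Icc 0 1) t = 0 := by
  induction M', hM using Nat.le_induction with
  | base => exact h
  | succ m _ ih =>
    intro t ht
    rw [iteratedDerivWithin_succ, derivWithin_congr (f := fun _ => (0 : ℝ)) ih (ih t ht)]
    simp

theorem AnnihilatedByPower.derivWithin {f g : ℝ → ℝ} (h : AnnihilatedByPower f)
    (hg : EqOn g (derivWithin f (Icc 0 1)) (Icc 0 1)) : AnnihilatedByPower g := by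
  obtain ⟨M, hM⟩ := h
  refine ⟨M, fun t ht => ?_⟩
  rw [iteratedDerivWithin_congr hg ht, ← iteratedDerivWithin_succ']
  exact iteratedDerivWithin_eq_zero_of_le M.le_succ hM t ht

theorem AnnihilatedByPower.congr {f g : ℝ → ℝ} (h : AnnihilatedByPower f)
    (hfg : EqOn f g (Icc 0 1)) : AnnihilatedByPower g := by
  obtain ⟨M, hM⟩ := h
  exact ⟨M, fun t ht => by rw [← iteratedDerivWithin_congr hfg ht]; exact hM t ht⟩

theorem AnnihilatedByPower.sub {f g : ℝ → ℝ} (hf : AnnihilatedByPower f)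
    (hg : AnnihilatedByPower g) (hf' : AnalyticOn ℝ f (Icc 0 1))
    (hg' : AnalyticOn ℝ g (Icc 0 1)) : AnnihilatedByPower (f - g) := by
  obtain ⟨M, hM⟩ := hf
  obtain ⟨M', hM'⟩ := hg
  have hu := uniqueDiffOn_Icc (zero_lt_one (α := ℝ))
  refine ⟨max M M', fun t ht => ?_⟩
  rw [iteratedDerivWithin_sub ht hu (hf'.contDiffOn hu t ht) (hg'.contDiffOn hu t ht),
    iteratedDerivWithin_eq_zero_of_le (le_max_left _ _) hM t ht,
    iteratedDerivWithin_eq_zero_of_le (le_max_right _ _) hM' t ht, sub_zero]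

theorem AnnihilatedByPower.const_mul {f : ℝ → ℝ} (h : AnnihilatedByPower f) (c : ℝ) :
    AnnihilatedByPower fun t => c * f t := by
  obtain ⟨M, hM⟩ := h
  exact ⟨M, fun t ht => by rw [iteratedDerivWithin_const_mul_field, hM t ht, mul_zero]⟩

theorem hasDerivWithinAt_of_contDiffOn {h : ℝ → ℝ} (hh : ContDiffOn ℝ (⊤ : ℕ∞) h (Icc 0 1))
    {t : ℝ} (ht : t ∈ Icc (0 : ℝ) 1) :
    HasDerivWithinAt h (derivWithin h (Icc 0 1) t) (Icc 0 1) t :=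
  ((hh.differentiableOn (by simp)) t ht).hasDerivWithinAt

theorem contDiffOn_derivWithin {h : ℝ → ℝ} (hh : ContDiffOn ℝ (⊤ : ℕ∞) h (Icc 0 1)) :
    ContDiffOn ℝ (⊤ : ℕ∞) (derivWithin h (Icc 0 1)) (Icc 0 1) :=
  hh.derivWithin (uniqueDiffOn_Icc zero_lt_one) (by exact_mod_cast le_top)

/-- Differentiating an Euler operator `t h' + a h` gives the Euler operator of `h'` for `a + 1`. -/
theorem derivWithin_euler {g h : ℝ → ℝ} {a : ℝ} (hh : ContDiffOn ℝ (⊤ : ℕ∞) h (Icc 0 1))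
    (hg : EqOn g (fun t => t * derivWithin h (Icc 0 1) t + a * h t) (Icc 0 1)) :
    EqOn (derivWithin g (Icc 0 1)) (fun t => t * derivWithin (derivWithin h (Icc 0 1)) (Icc 0 1) t +
      (a + 1) * derivWithin h (Icc 0 1) t) (Icc 0 1) := by
  intro t ht
  have h1 := hasDerivWithinAt_of_contDiffOn hh ht
  have h2 := hasDerivWithinAt_of_contDiffOn (contDiffOn_derivWithin hh) ht
  have h3 := ((hasDerivWithinAt_id t (Icc 0 1)).mul h2).add (h1.const_mul a)
  have h4 := (h3.congr (f₁ := g) (fun x hx => hg hx) (hg ht)).derivWithin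
    (uniqueDiffOn_Icc zero_lt_one t ht)
  rw [h4]
  simp only [id]
  ring

/-- The function `t h ^ 2` is nonnegative, vanishes at `0` and has derivative `(1 - 2 a) h ^ 2 ≤ 0`,
so it is zero. -/
theorem eq_zero_of_euler {h : ℝ → ℝ} {a : ℝ} (ha : 1 ≤ a)
    (hh : ContDiffOn ℝ (⊤ : ℕ∞) h (Icc 0 1))
    (h0 : ∀ t ∈ Icc (0 : ℝ) 1, t * derivWithin h (Icc 0 1) t + a * h t = 0) :
    ∀ t ∈ Icc (0 : ℝ) 1, h t = 0 := by
  have hder : ∀ x ∈ Icc (0 : ℝ) 1, HasDerivWithinAt (fun t => t * h t ^ 2)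
      (h x ^ 2 + x * (2 * h x * derivWithin h (Icc 0 1) x)) (Icc 0 1) x := by
    intro x hx
    have := (hasDerivWithinAt_id x (Icc 0 1)).mul ((hasDerivWithinAt_of_contDiffOn hh hx).pow 2)
    simpa using! this
  have hanti : AntitoneOn (fun t => t * h t ^ 2) (Icc (0 : ℝ) 1) := by
    refine antitoneOn_of_hasDerivWithinAt_nonpos (convex_Icc 0 1)
      (fun x hx => (hder x hx).continuousWithinAt)
      (fun x hx => (hder x (interior_subset hx)).mono interior_subset) fun x hx => ?_
    have h1 := h0 x (interior_subset hx)
    have h2 : h x ^ 2 + x * (2 * h x * derivWithin h (Icc 0 1) x) = (1 - 2 * a) * h x ^ 2 := by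
      linear_combination 2 * h x * h1
    rw [h2]
    exact mul_nonpos_of_nonpos_of_nonneg (by linarith) (sq_nonneg _)
  intro t ht
  rcases ht.1.eq_or_lt with h | hpos
  · subst h
    have := h0 0 ht
    rw [zero_mul, zero_add] at this
    exact (mul_eq_zero.1 this).resolve_left (by linarith)
  · have h1 := hanti (by simp) ht ht.1
    simp only [zero_mul] at h1
    have h2 : h t ^ 2 ≤ 0 := nonpos_of_mul_nonpos_right h1 hpos
    exact pow_eq_zero_iff two_ne_zero |>.1 (le_antisymm h2 (sq_nonneg _))

/-- For small `a` there may be nonzero solutions such as `t ^ (-a)`; each differentiation raises `a`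
by one, and `k` of them reach the case `a ≥ 1`. -/
theorem annihilatedByPower_of_euler_eq_zero (k : ℕ) {h : ℝ → ℝ} {a : ℝ} (ha : 1 ≤ a + k)
    (hh : ContDiffOn ℝ (⊤ : ℕ∞) h (Icc 0 1))
    (h0 : ∀ t ∈ Icc (0 : ℝ) 1, t * derivWithin h (Icc 0 1) t + a * h t = 0) :
    AnnihilatedByPower h := by
  induction k generalizing h a with
  | zero => exact ⟨0, fun t ht => eq_zero_of_euler (by simpa using ha) hh h0 t ht⟩
  | succ k ih =>
    refine .of_derivWithin (fun _ _ => rfl) (ih (a := a + 1) (by push_cast at ha; linarith)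
      (contDiffOn_derivWithin hh) fun t ht => ?_)
    refine (derivWithin_euler (g := fun _ => 0) hh (fun x hx => (h0 x hx).symm) ht).symm.trans ?_
    simp

/-- Differentiating `M` times reduces to the homogeneous Euler equation for the `M`-th derivative of
`h`, with `a + M` for `a`. -/
theorem annihilatedByPower_of_euler {g h : ℝ → ℝ} {a : ℝ}
    (hh : ContDiffOn ℝ (⊤ : ℕ∞) h (Icc 0 1))
    (hg : EqOn g (fun t => t * derivWithin h (Icc 0 1) t + a * h t) (Icc 0 1))
    (hann : AnnihilatedByPower g) : AnnihilatedByPower h := by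
  obtain ⟨M, hM⟩ := hann
  induction M generalizing g h a with
  | zero =>
    obtain ⟨k, hk⟩ := exists_nat_ge (1 - a)
    refine annihilatedByPower_of_euler_eq_zero k (a := a) (by linarith) hh fun t ht => ?_
    exact (hg ht).symm.trans (by simpa using hM t ht)
  | succ M ih =>
    refine .of_derivWithin (fun _ _ => rfl) (ih (g := derivWithin g (Icc 0 1))
      (contDiffOn_derivWithin hh) (derivWithin_euler hh hg) fun t ht => ?_)
    rw [← iteratedDerivWithin_succ']
    exact hM t ht

theorem contDiffOn_of_analyticOn {f : ℝ → ℝ} (hf : AnalyticOn ℝ f (Icc 0 1)) :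
    ContDiffOn ℝ (⊤ : ℕ∞) f (Icc 0 1) :=
  hf.contDiffOn (uniqueDiffOn_Icc zero_lt_one)

theorem AnnihilatedByPower.of_primitive {f : ℝ → ℝ} (hf : AnalyticOn ℝ f (Icc 0 1))
    (h : AnnihilatedByPower (primitive f)) : AnnihilatedByPower f :=
  h.derivWithin fun _ ht => ((hasDerivWithinAt_primitive hf.continuousOn ht).derivWithin
    (uniqueDiffOn_Icc zero_lt_one _ ht)).symm

theorem AnnihilatedByPower.of_primitive_iterate {f : ℝ → ℝ} (hf : AnalyticOn ℝ f (Icc 0 1)) (k : ℕ)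
    (h : AnnihilatedByPower (primitive^[k] f)) : AnnihilatedByPower f := by
  induction k with
  | zero => exact h
  | succ k ih =>
    rw [Function.iterate_succ_apply'] at h
    exact ih (h.of_primitive (analyticOn_primitive_iterate hf k))

/-- Factors `t` are removed one at a time: the derivative of `t h` is the Euler operator with `a =
1`. -/
theorem AnnihilatedByPower.of_pow_mul {f : ℝ → ℝ} (hf : AnalyticOn ℝ f (Icc 0 1)) (k : ℕ)
    (h : AnnihilatedByPower fun t => t ^ k * f t) : AnnihilatedByPower f := by
  induction k with
  | zero => simpa using h
  | succ k ih =>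
    have ha : AnalyticOn ℝ (fun t => t ^ k * f t) (Icc 0 1) := (analyticOn_id.pow k).mul hf
    refine ih (annihilatedByPower_of_euler (a := 1) (contDiffOn_of_analyticOn ha) (fun t ht => ?_)
      (h.derivWithin fun _ _ => rfl))
    have h1 := (hasDerivWithinAt_id t (Icc 0 1)).mul
      (hasDerivWithinAt_of_contDiffOn (contDiffOn_of_analyticOn ha) ht)
    refine ((h1.congr_of_mem (f₁ := fun t => t ^ (k + 1) * f t) (fun x _ => ?_) ht).derivWithin
      (uniqueDiffOn_Icc zero_lt_one t ht)).trans ?_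
    · simp only [Pi.mul_apply, id]; ring
    · simp only [id]; ring

theorem AnnihilatedByPower.of_mul_sub_primitive {f : ℝ → ℝ} (hf : AnalyticOn ℝ f (Icc 0 1))
    (j : ℕ) (h : AnnihilatedByPower fun t => t * f t - (j + 1) * primitive f t) :
    AnnihilatedByPower f := by
  refine annihilatedByPower_of_euler (a := -j) (contDiffOn_of_analyticOn hf) (fun t ht => ?_)
    (h.derivWithin fun _ _ => rfl)
  have h1 := ((hasDerivWithinAt_id t (Icc 0 1)).mul
    (hasDerivWithinAt_of_contDiffOn (contDiffOn_of_analyticOn hf) ht)).sub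
    ((hasDerivWithinAt_primitive hf.continuousOn ht).const_mul ((j : ℝ) + 1))
  refine (h1.derivWithin (uniqueDiffOn_Icc zero_lt_one t ht)).trans ?_
  simp only [id]
  ring

/-! ### Linear combinations of powers -/

/-- On `[0, 1]`, `f` is a linear combination of the powers `t ^ i` with `a ≤ i < b`. -/
def IsPowerComb (a b : ℕ) (f : ℝ → ℝ) : Prop :=
  ∃ c : ℕ → ℝ, ∀ t ∈ Icc (0 : ℝ) 1, f t = ∑ i ∈ Finset.Ico a b, c i * t ^ i

theorem primitive_powers {f : ℝ → ℝ} {a b : ℕ} {c : ℕ → ℝ}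
    (h : ∀ t ∈ Icc (0 : ℝ) 1, f t = ∑ i ∈ Finset.Ico a b, c i * t ^ i) :
    ∀ t ∈ Icc (0 : ℝ) 1, primitive f t = ∑ i ∈ Finset.Ico a b, c i / (i + 1) * t ^ (i + 1) := by
  intro t ht
  rw [primitive_congr h ht, primitive_sum _ (f := fun i t => c i * t ^ i)
    (fun _ _ => by fun_prop) ht]
  refine Finset.sum_congr rfl fun i _ => ?_
  rw [primitive_const_mul, primitive, integral_pow]
  simp
  ring

theorem sum_Ico_shift (a b : ℕ) (c : ℕ → ℝ) (t : ℝ) :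
    ∑ i ∈ Finset.Ico a b, c i * t ^ (i + 1) =
      ∑ i ∈ Finset.Ico (a + 1) (b + 1), c (i - 1) * t ^ i := by
  rw [← Finset.sum_Ico_add' (fun i => c (i - 1) * t ^ i) a b 1]
  simp

theorem IsPowerComb.primitive {a b : ℕ} {f : ℝ → ℝ} (h : IsPowerComb a b f) :
    IsPowerComb (a + 1) (b + 1) (primitive f) := by
  obtain ⟨c, hc⟩ := h
  exact ⟨fun i => c (i - 1) / ((i - 1 : ℕ) + 1), fun t ht => by
    rw [primitive_powers hc t ht, sum_Ico_shift a b (fun i => c i / (i + 1))]⟩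

theorem IsPowerComb.mul_self {a b : ℕ} {f : ℝ → ℝ} (h : IsPowerComb a b f) :
    IsPowerComb (a + 1) (b + 1) (fun t => t * f t) := by
  obtain ⟨c, hc⟩ := h
  refine ⟨fun i => c (i - 1), fun t ht => ?_⟩
  dsimp only
  rw [← sum_Ico_shift, hc t ht, Finset.mul_sum]
  exact Finset.sum_congr rfl fun i _ => by ring

theorem IsPowerComb.mono {a b a' b' : ℕ} {f : ℝ → ℝ} (h : IsPowerComb a b f) (ha : a' ≤ a)
    (hb : b ≤ b') : IsPowerComb a' b' f := by
  classical
  obtain ⟨c, hc⟩ := h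
  refine ⟨fun i => if i ∈ Finset.Ico a b then c i else 0, fun t ht => ?_⟩
  simp only [ite_mul, zero_mul]
  rw [Finset.sum_ite_mem, Finset.inter_eq_right.2 (Finset.Ico_subset_Ico ha hb), hc t ht]

theorem IsPowerComb.sum {ι : Type*} (s : Finset ι) {a b : ℕ} {f : ι → ℝ → ℝ} (w : ι → ℝ)
    (h : ∀ j ∈ s, IsPowerComb a b (f j)) : IsPowerComb a b (fun t => ∑ j ∈ s, w j * f j t) := by
  choose! c hc using h
  refine ⟨fun i => ∑ j ∈ s, w j * c j i, fun t ht => ?_⟩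
  simp only [Finset.sum_mul]
  rw [Finset.sum_comm]
  refine Finset.sum_congr rfl fun j hj => ?_
  rw [hc j hj t ht, Finset.mul_sum]
  exact Finset.sum_congr rfl fun i _ => by ring

theorem IsPowerComb.primitive_iterate {b : ℕ} {f : ℝ → ℝ} (h : IsPowerComb 0 b f) (k : ℕ) :
    IsPowerComb 0 (b + k) (BurstNoise.primitive^[k] f) := by
  induction k with
  | zero => exact h
  | succ k ih =>
    rw [Function.iterate_succ_apply']
    exact ih.primitive.mono (Nat.zero_le _) le_rfl

theorem IsPowerComb.pow_mul {b : ℕ} {f : ℝ → ℝ} (h : IsPowerComb 0 b f) (k : ℕ) :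
    IsPowerComb 0 (b + k) (fun t => t ^ k * f t) := by
  induction k with
  | zero => simpa using h
  | succ k ih =>
    have := ih.mul_self.mono (Nat.zero_le _) le_rfl
    simpa only [pow_succ', mul_assoc] using! this

theorem isPowerComb_eval {p : Polynomial ℝ} {d : ℕ} (hp : p.natDegree ≤ d) :
    IsPowerComb 0 (d + 1) (fun t => p.eval t) :=
  ⟨p.coeff, fun t _ => by
    dsimp only
    rw [Polynomial.eval_eq_sum_range' (Nat.lt_succ_of_le hp), Finset.range_eq_Ico]⟩

/-- The operator `f ↦ t f - (a + 1) ∫ f` kills the lowest power of a combination. -/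
theorem IsPowerComb.mul_sub_primitive {a b : ℕ} {f : ℝ → ℝ} (h : IsPowerComb a b f) :
    IsPowerComb (a + 2) (b + 1) (fun t => t * f t - (a + 1) * BurstNoise.primitive f t) := by
  obtain ⟨c, hc⟩ := h
  have key : ∀ t ∈ Icc (0 : ℝ) 1, t * f t - (a + 1) * BurstNoise.primitive f t =
      ∑ i ∈ Finset.Ico a b, c i * ((i - a) / (i + 1)) * t ^ (i + 1) := by
    intro t ht
    rw [primitive_powers hc t ht, hc t ht, Finset.mul_sum, Finset.mul_sum,
      ← Finset.sum_sub_distrib]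
    refine Finset.sum_congr rfl fun i _ => ?_
    field_simp
    ring
  rcases le_or_gt b a with hab | hab
  · refine ⟨0, fun t ht => (key t ht).trans ?_⟩
    rw [ Finset.Ico_eq_empty_of_le hab]
    simp
  · refine ⟨fun i => c (i - 1) * (((i - 1 : ℕ) - a) / ((i - 1 : ℕ) + 1)), fun t ht => (key t ht).trans ?_⟩
    -- The factor `i - a` vanishes at `i = a`, so the lowest term drops out.
    rw [Finset.sum_eq_sum_Ico_succ_bot hab,
      sum_Ico_shift (a + 1) b (fun i => c i * ((i - a) / (i + 1)))]
    simp

/-! ### Elimination of polynomials by iterated steps -/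

namespace IntegralForm

/-- The bound is uniform in `p`, so that the number of steps depends only on the form and on `d`. -/
theorem exists_isPowerComb_lin (E : IntegralForm) (d : ℕ) :
    ∃ b, ∀ p : Polynomial ℝ, p.natDegree ≤ d → IsPowerComb 0 b (E.lin fun τ => p.eval τ) := by
  refine ⟨d + 1 + E.coeff.support.sup fun i => i.2 + (i.1 + 1), fun p hp => ?_⟩
  refine IsPowerComb.sum E.coeff.support _ fun i hi => ?_
  refine (((isPowerComb_eval hp).pow_mul i.2).primitive_iterate (i.1 + 1)).mono le_rfl ?_
  have := Finset.le_sup (f := fun i : ℕ × ℕ => i.2 + (i.1 + 1)) hi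
  omega

/-- The successive application of the operators `E.step (2 * s)` for `s < r`. -/
def steps (E : IntegralForm) : ℕ → IntegralForm
  | 0 => E
  | r + 1 => (E.steps r).step (2 * r)

theorem isPowerComb_lin_steps (E : IntegralForm) {u : ℝ → ℝ} (hu : ContinuousOn u (Icc 0 1))
    {b : ℕ} (h : IsPowerComb 0 b (E.lin u)) (r : ℕ) :
    IsPowerComb (2 * r) (b + r) ((E.steps r).lin u) := by
  induction r with
  | zero => exact h
  | succ r ih =>
    obtain ⟨c, hc⟩ := ih.mul_sub_primitive
    refine ⟨c, fun t ht => ?_⟩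
    rw [steps, lin_step _ _ hu ht]
    exact hc t ht

theorem lin_steps_eq_zero (E : IntegralForm) {u : ℝ → ℝ} (hu : ContinuousOn u (Icc 0 1))
    {b : ℕ} (h : IsPowerComb 0 b (E.lin u)) : ∀ t ∈ Icc (0 : ℝ) 1, (E.steps b).lin u t = 0 := by
  obtain ⟨c, hc⟩ := E.isPowerComb_lin_steps hu h b
  intro t ht
  rw [hc t ht, two_mul]
  simp

theorem std_steps_mul {P Q : IntegralForm} {u : ℝ → ℝ} (hu : ContinuousOn u (Icc 0 1)) {θ : ℝ}
    (h : ∀ t ∈ Icc (0 : ℝ) 1, P.std u t * θ = Q.std u t) (r : ℕ) :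
    ∀ t ∈ Icc (0 : ℝ) 1, (P.steps r).std u t * θ = (Q.steps r).std u t := by
  induction r with
  | zero => exact h
  | succ r ih =>
    intro t ht
    have hprim : primitive ((Q.steps r).std u) t = θ * primitive ((P.steps r).std u) t := by
      rw [← primitive_const_mul]
      exact primitive_congr (fun x hx => by rw [← ih x hx, mul_comm]) ht
    rw [steps, steps, std_step _ _ hu ht, std_step _ _ hu ht, hprim, ← ih t ht]
    ring

theorem annihilatedByPower_of_std_steps (E : IntegralForm) {u : ℝ → ℝ}
    (hu : AnalyticOn ℝ u (Icc 0 1)) (r : ℕ) (h : AnnihilatedByPower ((E.steps r).std u)) :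
    AnnihilatedByPower (E.std u) := by
  induction r with
  | zero => exact h
  | succ r ih =>
    exact ih (.of_mul_sub_primitive ((E.steps r).analyticOn_std hu) (2 * r)
      (h.congr fun t ht => by rw [steps, std_step _ _ hu.continuousOn ht]))

/-- A single term can be inverted: remove the known part, differentiate away the integrals, then
strip the power of `t`. -/
theorem annihilatedByPower_of_std (E : IntegralForm) {u : ℝ → ℝ} (hu : AnalyticOn ℝ u (Icc 0 1))
    {i : ℕ × ℕ} {c : ℝ} (hc : c ≠ 0) (hE : E.coeff = Finsupp.single i c)
    (hk : AnnihilatedByPower E.known) (h : AnnihilatedByPower (E.std u)) :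
    AnnihilatedByPower u := by
  have h1 := ((h.sub hk (E.analyticOn_std hu) E.known_analytic).const_mul c⁻¹).congr
    (g := primitive^[i.1 + 1] fun τ => τ ^ i.2 * u τ) fun t _ => by
      simp [std, lin, hE, hc]
  exact (h1.of_primitive_iterate ((analyticOn_id.pow _).mul hu)).of_pow_mul hu

theorem unifClose_hyper (E : IntegralForm) {n : ℕ → ℕ} {F : ℕ → ℕ → ℝ} {f : ℝ → ℝ}
    (hn : Tendsto n (hyperfilter ℕ) atTop) (hf : ContinuousOn f (Icc 0 1))
    (hF : UnifClose n (fun i => sumUpTo (n i) (F i)) (primitive f)) :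
    UnifClose n (fun i k => E.known ((k : ℝ) / n i) + E.gridLin (n i) (F i) k) (E.std f) :=
  (unifClose_grid n E.known).add (E.unifClose_gridLin hn hf hF)

end IntegralForm

/-- The error of the quotient estimate `q / δ`, read as `0` where `δ = 0`, multiplied by `δ`. -/
theorem tendsto_mul_div_sub {δ q : ℕ → ℝ} {θ : ℝ}
    (h : Tendsto (fun i => q i - θ * δ i) (hyperfilter ℕ) (𝓝 0)) :
    Tendsto (fun i => δ i * (q i / δ i - θ)) (hyperfilter ℕ) (𝓝 0) := by
  refine squeeze_zero_norm (fun i => ?_) (tendsto_zero_iff_norm_tendsto_zero.1 h)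
  rcases eq_or_ne (δ i) 0 with h0 | h0
  · simp [h0]
  · refine (congrArg norm ?_).le
    field_simp

end BurstNoise

end

/-! ### The estimator and its properties -/

open BurstNoise in
theorem proposition4 (P Q : IntegralForm) (d : ℕ) :
    -- the estimator depends only on the identifiability relation and on the bound for the degree
    ∃ P' Q' : IntegralForm,
      -- it annihilates the polynomials of degree at most `d`
      (∀ p : Polynomial ℝ, p.natDegree ≤ d → ∀ t ∈ Set.Icc (0 : ℝ) 1,
        P'.lin (fun τ => p.eval τ) t = 0 ∧ Q'.lin (fun τ => p.eval τ) t = 0) ∧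
      -- for every symbol, signal, noise mean and noise
      ∀ (N : Hypernat), Unlimited N →
      ∀ (θ : ℝ) (x : InternalFun) (xbar : ℝ → ℝ), HasShadow N x xbar →
        AnalyticOn ℝ xbar (Set.Icc 0 1) → Identifies P Q xbar θ →
        ¬ AnnihilatedByPower xbar →
      ∀ (m noise : InternalFun) (p : Polynomial ℝ), p.natDegree ≤ d →
        HasShadow N m (fun t => p.eval t) → IsNoise N m noise →
        -- the divisor
        (AnalyticOn ℝ (P'.std xbar) (Set.Icc 0 1) ∧ P'.std xbar 0 = 0 ∧
          HasShadow N (P'.hyper N (x + noise)) (P'.std xbar)) ∧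
        -- the error formula, with the noise freed from its polynomial part
        (∀ K : Hypernat, K ≤ N →
          Near ((P'.hyper N (x + noise)).eval K *
              (estimate P' Q' N (x + noise) K - (θ : ℝ*)))
            ((Q'.hyperLin N (noise - onGrid N (fun t => p.eval t))).eval K -
              (θ : ℝ*) * (P'.hyperLin N (noise - onGrid N (fun t => p.eval t))).eval K)) ∧
        -- the divisor is not identically zero
        (¬ AnnihilatedByPower (P.std xbar) → ∃ t ∈ Set.Icc (0 : ℝ) 1, P'.std xbar t ≠ 0) ∧
        (∀ (i : ℕ × ℕ) (c : ℝ), c ≠ 0 → P.coeff = Finsupp.single i c →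
          AnnihilatedByPower P.known → ∃ t ∈ Set.Icc (0 : ℝ) 1, P'.std xbar t ≠ 0) ∧
        -- the estimate is in the halo of the symbol
        (∀ K : Hypernat, K ≤ N →
          (∀ z ∈ Set.Icc (0 : ℝ) 1, P'.std xbar z = 0 → ¬ Near (time N K) (z : ℝ*)) →
          (P'.hyper N (x + noise)).eval K ≠ 0 ∧
            Near (estimate P' Q' N (x + noise) K) (θ : ℝ*)) := by
  obtain ⟨bP, hbP⟩ := P.exists_isPowerComb_lin d
  obtain ⟨bQ, hbQ⟩ := Q.exists_isPowerComb_lin d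
  -- Both forms take the same number of steps, so that the relation with `θ` survives.
  set b := max bP bQ
  have hpoly : ∀ p : Polynomial ℝ, ContinuousOn (fun τ => p.eval τ) (Set.Icc 0 1) :=
    fun p => p.continuous.continuousOn
  have hPlin : ∀ p : Polynomial ℝ, p.natDegree ≤ d → ∀ t ∈ Set.Icc (0 : ℝ) 1,
      (P.steps b).lin (fun τ => p.eval τ) t = 0 := fun p hp =>
    P.lin_steps_eq_zero (hpoly p) ((hbP p hp).mono le_rfl (le_max_left _ _))
  have hQlin : ∀ p : Polynomial ℝ, p.natDegree ≤ d → ∀ t ∈ Set.Icc (0 : ℝ) 1,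
      (Q.steps b).lin (fun τ => p.eval τ) t = 0 := fun p hp =>
    Q.lin_steps_eq_zero (hpoly p) ((hbQ p hp).mono le_rfl (le_max_right _ _))
  refine ⟨P.steps b, Q.steps b, fun p hp t ht => ⟨hPlin p hp t ht, hQlin p hp t ht⟩, ?_⟩
  have hnz : ∀ xbar : ℝ → ℝ, AnalyticOn ℝ xbar (Set.Icc 0 1) →
      ¬ AnnihilatedByPower (P.std xbar) →
      ∃ t ∈ Set.Icc (0 : ℝ) 1, (P.steps b).std xbar t ≠ 0 := by
    intro xbar hx h
    by_contra! hcon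
    exact h (P.annihilatedByPower_of_std_steps hx b ⟨0, fun t ht => by simpa using hcon t ht⟩)
  clear_value b
  intro N hN θ x xbar hx hxa hid hxann m noise p hp hm hnoise
  have combine : ∀ {A B C D E : Prop}, C → D → A ∧ B ∧ E → A ∧ B ∧ C ∧ D ∧ E :=
    fun hC hD h => ⟨h.1, h.2.1, hC, hD, h.2.2⟩
  refine combine (hnz xbar hxa) (fun i c hc hP hk => hnz xbar hxa fun h =>
    hxann (P.annihilatedByPower_of_std hxa hc hP hk h)) ?_
  induction N using Germ.inductionOn with | _ n
  induction x using Germ.inductionOn with | _ x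
  induction m using Germ.inductionOn with | _ m
  induction noise using Germ.inductionOn with | _ F
  have hn := hN.tendsto
  have hxc := hxa.continuousOn
  have hF := hnoise.unifClose_sumUpTo hN (hpoly p) hm
  have hsum : UnifClose n (fun i => sumUpTo (n i) fun j => x i j + F i j)
      (primitive fun t => xbar t + p.eval t) := by
    have h := (((hasShadow_coe_iff hxc).1 hx).sumUpTo hn hxc).add hF
    simp only [← sumUpTo_add] at h
    exact h.congr fun t ht => (primitive_add hxc (hpoly p) ht).symm
  have hclose : ∀ E : IntegralForm, (∀ t ∈ Set.Icc (0 : ℝ) 1, E.lin (fun τ => p.eval τ) t = 0) →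
      UnifClose n (fun i k => E.known ((k : ℝ) / n i) + E.gridLin (n i) (fun j => x i j + F i j) k)
        (E.std xbar) := by
    intro E hE
    refine (E.unifClose_hyper hn (hxc.add (hpoly p)) hsum).congr fun t ht => ?_
    have := E.lin_add hxc (hpoly p) ht
    simp only [hE t ht, add_zero] at this
    exact congrArg (E.known t + ·) this
  have hδ := hclose _ (hPlin p hp)
  have hq := hclose _ (hQlin p hp)
  have hδa := (P.steps b).analyticOn_std hxa
  have hrel := IntegralForm.std_steps_mul hxc hid.1 b
  -- Freed from `p`, the noise has infinitesimal cumulative sums, hence infinitesimal image under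
  -- every linear part.
  have hn0 : ∀ E : IntegralForm,
      UnifClose n (fun i => E.gridLin (n i) fun j => F i j - p.eval ((j : ℝ) / n i))
        (fun _ => 0) := by
    intro E
    have h := hF.sub ((unifClose_grid n fun t => p.eval t).sumUpTo hn (hpoly p))
    simp only [← sumUpTo_sub, sub_self] at h
    refine (E.unifClose_gridLin hn (f := fun _ => 0) continuousOn_const
      (h.congr fun t _ => by simp [primitive])).congr fun t ht => ?_
    have := E.lin_add (u := fun _ => 0) (v := fun _ => 0) continuousOn_const continuousOn_const ht
    simp only [add_zero] at this
    linarith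
  refine ⟨⟨hδa, (P.steps b).std_zero xbar, (hasShadow_coe_iff hδa.continuousOn).2 hδ⟩, ?_, ?_⟩
  · intro K hK
    induction K using Germ.inductionOn with | _ k
    have hk := Germ.coe_le.1 hK
    -- Each side of the error formula is infinitesimal by itself; `h1` treats the left side and `h2`
    -- the right.
    have h1 := tendsto_mul_div_sub (θ := θ)
      (δ := fun i => (P.steps b).known ((k i : ℝ) / n i) +
        (P.steps b).gridLin (n i) (fun j => x i j + F i j) (k i))
      (q := fun i => (Q.steps b).known ((k i : ℝ) / n i) +
        (Q.steps b).gridLin (n i) (fun j => x i j + F i j) (k i)) (by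
        have h := (hq.tendsto hk).sub ((hδ.tendsto hk).const_mul θ)
        rw [mul_zero, sub_zero] at h
        refine h.congr' (hk.mono fun i hi => ?_)
        rw [← hrel _ (div_mem_Icc hi)]
        ring)
    have h2 := ((hn0 (Q.steps b)).tendsto hk).sub (((hn0 (P.steps b)).tendsto hk).const_mul θ)
    have h3 := h1.sub h2
    simp only [mul_zero, sub_zero] at h3
    refine near_ofSeq.2 fun ε hε => ?_
    filter_upwards [Metric.tendsto_nhds.1 h3 ε hε] with i hi
    rwa [Real.dist_eq, sub_zero] at hi
  · intro K hK hz
    obtain ⟨t, ht, hKt⟩ := exists_near_time hK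
    induction K using Germ.inductionOn with | _ k
    have hk := Germ.coe_le.1 hK
    have hne : (P.steps b).std xbar t ≠ 0 := fun h => hz t ht h hKt
    have hδt := (hasShadow_coe_iff hδa.continuousOn).2 hδ _ hK t ht hKt
    have hqt := (hasShadow_coe_iff ((Q.steps b).analyticOn_std hxa).continuousOn).2 hq _ hK t ht hKt
    -- If `δ` vanished at the grid point, its limit, the nonzero value of the divisor at `t`, would
    -- be `0`.
    refine ⟨fun h => ?_, ?_⟩
    · have h0 := near_ofSeq_coe.1 hδt
      have h1 : Tendsto _ _ (nhds (0 : ℝ)) := near_ofSeq_zero (a := fun i =>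
        (P.steps b).known ((k i : ℝ) / n i) +
          (P.steps b).gridLin (n i) (fun j => x i j + F i j) (k i)).1 (by
        refine (congrArg (Near · 0) h).mpr ?_
        intro ε hε
        simpa using hε)
      exact hne (tendsto_nhds_unique h0 h1)
    · have h := (near_ofSeq_coe.1 hqt).div (near_ofSeq_coe.1 hδt) hne
      rw [← hrel t ht, mul_div_cancel_left₀ _ hne] at h
      exact near_ofSeq_coe.2 h
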